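/- Let $\mathcal H=\bigotimes_{k}\mathbb C^{d_k}$ be the joint space of finitely many parties, each holding a finite-dimensional system. By a finite-round LOCC protocol we mean a finite tree of steps in which, at each step, one party performs a local measurement (Kraus operators $A_a$ on its own system with $\sum_a A_a^\dagger A_a=\mathbb 1$) and broadcasts the outcome, the next step may depend on all earlier outcomes, and each branch ends with a classical output; it induces a POVM on $\mathcal H$, indexed by the outputs. A family of states $\rho_1,\dots,\rho_N$ on $\mathcal H$ is called locally antidistinguishable in the strong sense if there is a POVM $\{\Pi_j\}_{j=1}^N$ on $\mathcal H$, induced by a finite-round LOCC protocol, such that $\operatorname{Tr}(\rho_j\Pi_j)=0$ and $\sum_{i=1}^N\operatorname{Tr}(\rho_i\Pi_j)>0$ for every $j\in\{1,\dots,N\}$. Lemma. Let $N\ge 2$ and let $|\psi_1\rangle,\dots,|\psi_N\rangle\in\mathcal H$ be mutually orthogonal unit vectors (multipartite pure states). Then the family $|\psi_1\rangle\langle\psi_1|,\dots,|\psi_N\rangle\langle\psi_N|$ is locally antidistinguishable in the strong sense. Moreover, this can be achieved as follows. For $i=1,\dots,\lceil N/2\rceil$ consider the pair $(\psi_{2i-1},\psi_{2i})$,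 with indices read cyclically modulo $N$ (so for odd $N$ the last pair is $(\psi_N,\psi_1)$). There are finite-round LOCC protocols $\mathcal P_i$, with $\mathcal P_i$ perfectly discriminating the two states of the $i$-th pair, such that for every probability distribution $(p_i)$ with all $p_i>0$ the following measurement is a POVM, is induced by a finite-round LOCC protocol, and satisfies the two conditions above: draw $i$ with probability $p_i$ by shared randomness, run $\mathcal P_i$, and announce as excluded the state of the $i$-th pair that $\mathcal P_i$ did not identify. -/

import Mathlib

open scoped Matrix ComplexOrder

noncomputable section

namespace QuantumExclusion

/-! ### States, measurements and strong antidistinguishability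

A finite-dimensional quantum system is `ℂ^X` for a finite type `X`. -/

/-- The density matrix `|ψ⟩⟨ψ|` of a state vector `ψ`. -/
def pureState {X : Type*} [Fintype X] (ψ : EuclideanSpace ℂ X) : Matrix X X ℂ :=
  Matrix.vecMulVec (fun x => ψ x) (fun x => star (ψ x))

/-- The Born probability `Tr (ρ E)` of the effect `E` in the state `ρ`. -/
def prob {X : Type*} [Fintype X] (ρ E : Matrix X X ℂ) : ℝ := (ρ * E).trace.re

/-- A positive operator-valued measure with finitely many outcomes. -/
structure IsPOVM {X Ω : Type*} [Fintype X] [DecidableEq X] [Fintype Ω]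
    (M : Ω → Matrix X X ℂ) : Prop where
  posSemidef : ∀ ω, (M ω).PosSemidef
  sum_eq_one : ∑ ω, M ω = 1

/-- The two conditions of strong antidistinguishability: outcome `j` never occurs in the state
`ρ j`, and every outcome occurs with nonzero probability for some state of the family. -/
structure StronglyExcludes {X : Type*} [Fintype X] {N : ℕ}
    (ρ M : Fin N → Matrix X X ℂ) : Prop where
  perfect_exclusion : ∀ j, (ρ j * M j).trace = 0
  outcome_relevance : ∀ j, 0 < ∑ i, prob (ρ i) (M j)

/-! ### LOCC

Parties are the elements of a finite type `κ`; party `k` holds `ℂ^(ι k)`, and the joint system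
`⨂ k, ℂ^(ι k)` is `ℂ^(∀ k, ι k)` through the product basis. -/

/-- The operator `A ⊗ 𝟙` on the joint system: `A` acts on party `k`, the identity on all others. -/
def localOp {κ : Type*} [Fintype κ] [DecidableEq κ] {ι : κ → Type*}
    [∀ k, DecidableEq (ι k)] (k : κ) (A : Matrix (ι k) (ι k) ℂ) :
    Matrix (∀ k, ι k) (∀ k, ι k) ℂ :=
  Matrix.of fun x y => if ∀ j, j ≠ k → x j = y j then A (x k) (y k) else 0

/-- A finite-round LOCC protocol with final classical output in `Ω`. Either the parties announce
an output, or one party `k` performs a local measurement with Kraus operators `A 0, …, A (n-1)`,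
broadcasts the outcome `a`, and the parties go on with a protocol that may depend on `a`. -/
inductive LOCC {κ : Type*} (ι : κ → Type*) [∀ k, Fintype (ι k)] [∀ k, DecidableEq (ι k)]
    (Ω : Type*)
  | output (ω : Ω) : LOCC ι Ω
  | measure (k : κ) (n : ℕ) (A : Fin n → Matrix (ι k) (ι k) ℂ)
      (complete : ∑ a, (A a)ᴴ * A a = 1) (next : Fin n → LOCC ι Ω) : LOCC ι Ω

namespace LOCC

/-- Classical post-processing of the output of a protocol. -/
def map {κ : Type*} {ι : κ → Type*} [∀ k, Fintype (ι k)] [∀ k, DecidableEq (ι k)]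
    {Ω Ω' : Type*} (f : Ω → Ω') : LOCC ι Ω → LOCC ι Ω'
  | output ω => output (f ω)
  | measure k n A h next => measure k n A h fun a => (next a).map f

/-- The effect, on the joint system, of obtaining the output `ω`: the sum of `Kᴴ K` over all
branches with output `ω`, where `K` is the product of the Kraus operators along the branch. -/
def effect {κ : Type*} [Fintype κ] [DecidableEq κ] {ι : κ → Type*} [∀ k, Fintype (ι k)]
    [∀ k, DecidableEq (ι k)] {Ω : Type*} [DecidableEq Ω] :
    LOCC ι Ω → Ω → Matrix (∀ k, ι k) (∀ k, ι k) ℂ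
  | output ω', ω => if ω = ω' then 1 else 0
  | measure k _ A _ next, ω =>
      ∑ a, (localOp k (A a))ᴴ * (next a).effect ω * localOp k (A a)

end LOCC

/-- The measurement `M` on the joint system is implemented by some LOCC protocol. -/
def IsLOCC {κ : Type*} [Fintype κ] [DecidableEq κ] {ι : κ → Type*} [∀ k, Fintype (ι k)]
    [∀ k, DecidableEq (ι k)] {Ω : Type*} [DecidableEq Ω]
    (M : Ω → Matrix (∀ k, ι k) (∀ k, ι k) ℂ) : Prop :=
  ∃ P : LOCC ι Ω, ∀ ω, M ω = P.effect ω

/-- Local antidistinguishability (in the strong sense) of a family of multipartite states. -/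
def LocallyAntidistinguishable {κ : Type*} [Fintype κ] [DecidableEq κ] {ι : κ → Type*}
    [∀ k, Fintype (ι k)] [∀ k, DecidableEq (ι k)] {N : ℕ}
    (ρ : Fin N → Matrix (∀ k, ι k) (∀ k, ι k) ℂ) : Prop :=
  ∃ M : Fin N → Matrix (∀ k, ι k) (∀ k, ι k) ℂ, IsPOVM M ∧ IsLOCC M ∧ StronglyExcludes ρ M

/-- The protocol `P` perfectly discriminates `ρ₀` (output `0`) from `ρ₁` (output `1`). -/
def Discriminates {κ : Type*} [Fintype κ] [DecidableEq κ] {ι : κ → Type*}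
    [∀ k, Fintype (ι k)] [∀ k, DecidableEq (ι k)] (P : LOCC ι (Fin 2))
    (ρ₀ ρ₁ : Matrix (∀ k, ι k) (∀ k, ι k) ℂ) : Prop :=
  prob ρ₀ (P.effect 0) = 1 ∧ prob ρ₁ (P.effect 1) = 1

/-! ### Shared randomness over a cyclic pairing -/

/-- The first index of pair `i`: the pairs are `{0,1}, {2,3}, …`, where for odd `N` the last one
is `{N-1, 0}`. -/
def pairFst (N : ℕ) (i : Fin ((N + 1) / 2)) : Fin N := ⟨2 * i, by have := i.isLt; omega⟩

/-- The second index of pair `i`, taken cyclically. -/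
def pairSnd (N : ℕ) (i : Fin ((N + 1) / 2)) : Fin N :=
  ⟨(2 * i + 1) % N, Nat.mod_lt _ (by have := i.isLt; omega)⟩

/-- The measurement of the parties who draw `i` with probability `p i` by shared randomness, run
`P i`, and exclude the second state of pair `i` on output `0`, the first one on output `1`. -/
def randomizedExclusion {κ : Type*} [Fintype κ] [DecidableEq κ] {ι : κ → Type*}
    [∀ k, Fintype (ι k)] [∀ k, DecidableEq (ι k)] {N : ℕ} (p : Fin ((N + 1) / 2) → ℝ)
    (P : Fin ((N + 1) / 2) → LOCC ι (Fin 2)) (j : Fin N) :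
    Matrix (∀ k, ι k) (∀ k, ι k) ℂ :=
  ∑ i, (p i : ℂ) • ((P i).map fun o => if o = 0 then pairSnd N i else pairFst N i).effect j

end QuantumExclusion

end

open QuantumExclusion

/-! ### Isotropic frames and resolutions of the identity. -/

noncomputable section

namespace QuantumExclusion

/-! The core is local discrimination of two orthogonal vectors `f`, `g` (Walgate et al.), by
induction on the parties yet to measure. The functional `X ↦ ⟨f, (X ⊗ 𝟙) g⟩` vanishes at `1`, so by
`exists_rankOne_resolution_of_apply_one_eq_zero` it vanishes at each term of some rank-one
resolution of the identity. Measuring these terms keeps the two vectors orthogonal on every branch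
and resets the party to a fixed basis state. Once all parties have measured, both vectors are
multiples of one basis vector, so one of them is zero. The resolution comes from rotating a basis,
two vectors at a time, until the two Hermitian forms that make up the functional vanish on it.

For exclusion, every state lies in some pair. A protocol never misidentifies a state of its own
pair, so that state is never excluded wrongly; its partner makes the exclusion occur with positive
probability. -/

/-- If the Hermitian form `g` vanishes at every vector of `v` and the values of the Hermitian form
`h` on `v` sum to zero, then both vanish at every vector of some family `w` that has the same sum
as `v` for every sesquilinear form. -/
theorem exists_frame_isotropic_of_sum_eq_zero {V n : Type*} [AddCommGroup V] [Module ℂ V]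
    [Fintype n] (g h : V →ₗ⋆[ℂ] V →ₗ[ℂ] ℂ) (hg : ∀ x y, star (g x y) = g y x)
    (hh : ∀ x y, star (h x y) = h y x) (v : n → V) (hgv : ∀ i, g (v i) (v i) = 0)
    (hhv : ∑ i, h (v i) (v i) = 0) :
    ∃ w : n → V, (∀ i, g (w i) (w i) = 0) ∧ (∀ i, h (w i) (w i) = 0) ∧
      ∀ s : V →ₗ⋆[ℂ] V →ₗ[ℂ] ℂ, ∑ i, s (w i) (w i) = ∑ i, s (v i) (v i) := by
  classical
  induction hm : (Finset.univ.filter fun i => h (v i) (v i) ≠ 0).card using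
    Nat.strong_induction_on generalizing v with
  | _ m ih =>
  by_cases hz : ∀ i, h (v i) (v i) = 0
  · exact ⟨v, hgv, hz, fun _ => rfl⟩
  have him : ∀ x, (h x x).im = 0 := fun x => Complex.conj_eq_iff_im.1 (hh x x)
  have hre : ∀ i, h (v i) (v i) ≠ 0 ↔ (h (v i) (v i)).re ≠ 0 := fun i => by
    rw [ne_eq, ne_eq, Complex.ext_iff]; simp [him]
  have hsum : ∑ i, (h (v i) (v i)).re = 0 := by
    have := congrArg Complex.re hhv
    simpa using this
  push Not at hz
  obtain ⟨l, hl⟩ := hz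
  have hl' := (hre l).1 hl
  obtain ⟨i, -, hi⟩ := Finset.exists_pos_of_sum_zero_of_exists_nonzero _ hsum
    ⟨l, Finset.mem_univ _, hl'⟩
  obtain ⟨j, -, hj⟩ := Finset.exists_pos_of_sum_zero_of_exists_nonzero
    (fun i => -(h (v i) (v i)).re) (by simp [hsum]) ⟨l, Finset.mem_univ _, neg_ne_zero.2 hl'⟩
  have hij : i ≠ j := by rintro rfl; linarith
  -- This phase makes `g (v i) (c • v j)` purely imaginary, so `g` vanishes on the whole real span
  -- of `a` and `b`, and rotating there to improve `h` does not disturb `g`.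
  obtain ⟨c, hc, hcg⟩ : ∃ c : ℂ, star c * c = 1 ∧ (c * g (v i) (v j)).re = 0 := by
    by_cases h0 : g (v i) (v j) = 0
    · exact ⟨1, by simp, by simp [h0]⟩
    · have hn : (‖g (v i) (v j)‖ : ℂ) ≠ 0 := by simpa using h0
      have hcm := Complex.conj_mul' (g (v i) (v j))
      refine ⟨Complex.I * star (g (v i) (v j)) / ‖g (v i) (v j)‖, ?_, ?_⟩
      · simp only [Complex.star_def, map_div₀, map_mul, Complex.conj_I, Complex.conj_conj,
          Complex.conj_ofReal]
        field_simp
        rw [Complex.I_sq, mul_comm, ← hcm]; ring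
      · have : Complex.I * star (g (v i) (v j)) / ‖g (v i) (v j)‖ * g (v i) (v j) =
            Complex.I * (‖g (v i) (v j)‖ : ℝ) := by
          rw [Complex.star_def]
          field_simp
          exact hcm
        rw [this]; simp
  set a := v i with ha
  set b := c • v j with hb
  have hbb : ∀ s : V →ₗ⋆[ℂ] V →ₗ[ℂ] ℂ, s b b = s (v j) (v j) := fun s => by
    simp only [hb, map_smul, LinearMap.map_smulₛₗ, LinearMap.smul_apply, smul_eq_mul,
      starRingEnd_apply]
    linear_combination (s (v j) (v j)) * hc
  have hgab : g a b + g b a = 0 := by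
    rw [← hg a b, Complex.star_def, Complex.add_conj]
    have : g a b = c * g (v i) (v j) := by simp [hb, ha]
    rw [this, hcg]; simp
  have expand : ∀ (s : V →ₗ⋆[ℂ] V →ₗ[ℂ] ℂ) (x y : ℝ),
      s ((x : ℂ) • a + (y : ℂ) • b) ((x : ℂ) • a + (y : ℂ) • b) =
        x ^ 2 * s a a + y ^ 2 * s b b + x * y * (s a b + s b a) := fun s x y => by
    simp only [map_add, map_smul, LinearMap.map_smulₛₗ, LinearMap.smul_apply, smul_eq_mul,
      LinearMap.add_apply, Complex.conj_ofReal]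
    ring
  -- The expression is `h` at the rotated vector: positive at `t = 0`, negative at `t = π / 2`.
  obtain ⟨t, -, ht⟩ : ∃ t ∈ Set.Icc 0 (Real.pi / 2), (Real.cos t ^ 2 * (h a a).re +
      Real.sin t ^ 2 * (h b b).re + Real.cos t * Real.sin t * (h a b + h b a).re) = 0 := by
    have hcont : ContinuousOn (fun t : ℝ => Real.cos t ^ 2 * (h a a).re +
      Real.sin t ^ 2 * (h b b).re + Real.cos t * Real.sin t * (h a b + h b a).re)
      (Set.Icc 0 (Real.pi / 2)) := by fun_prop
    refine intermediate_value_Icc' (by positivity) hcont ⟨?_, ?_⟩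
    · simp only [Real.cos_pi_div_two, Real.sin_pi_div_two, hbb h]
      norm_num; linarith
    · simp only [Real.cos_zero, Real.sin_zero]
      norm_num; exact hi.le
  set p : V := ((Real.cos t : ℝ) : ℂ) • a + ((Real.sin t : ℝ) : ℂ) • b with hp
  set q : V := ((-Real.sin t : ℝ) : ℂ) • a + ((Real.cos t : ℝ) : ℂ) • b with hq
  have hcs : ((Real.cos t : ℝ) : ℂ) ^ 2 + ((Real.sin t : ℝ) : ℂ) ^ 2 = 1 := by
    norm_cast; exact Real.cos_sq_add_sin_sq t
  have hpq : ∀ s : V →ₗ⋆[ℂ] V →ₗ[ℂ] ℂ, s p p + s q q = s (v i) (v i) + s (v j) (v j) :=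
    fun s => by
    rw [hp, hq, expand, expand, ← hbb s, ← ha]
    push_cast at hcs ⊢
    linear_combination (s a a + s b b) * hcs
  have hpz : h p p = 0 := by
    refine Complex.ext ?_ (him p)
    rw [hp, expand, Complex.zero_re, ← ht]
    simp only [← Complex.ofReal_pow, ← Complex.ofReal_mul, Complex.add_re, Complex.re_ofReal_mul]
  have hga : g a a = 0 := hgv i
  have hgb : g b b = 0 := by rw [hbb, hgv]
  set w : n → V := Function.update (Function.update v j q) i p with hw
  have hwi : w i = p := by simp [hw]
  have hwj : w j = q := by simp [hw, hij.symm]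
  have hwo : ∀ l, l ≠ i → l ≠ j → w l = v l := fun l h1 h2 => by simp [hw, h1, h2]
  have hsw : ∀ s : V →ₗ⋆[ℂ] V →ₗ[ℂ] ℂ, ∑ l, s (w l) (w l) = ∑ l, s (v l) (v l) := fun s => by
    have hji : j ∈ Finset.univ.erase i := by simp [hij.symm]
    rw [← Finset.add_sum_erase _ _ (Finset.mem_univ i), ← Finset.add_sum_erase _ _ hji,
      ← Finset.add_sum_erase _ (fun l => s (v l) (v l)) (Finset.mem_univ i),
      ← Finset.add_sum_erase _ (fun l => s (v l) (v l)) hji, hwi, hwj, ← add_assoc, ← add_assoc,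
      hpq]
    congr 1
    refine Finset.sum_congr rfl fun l hl => ?_
    simp only [Finset.mem_erase] at hl
    rw [hwo l hl.2.1 hl.1]
  have hgw : ∀ l, g (w l) (w l) = 0 := fun l => by
    by_cases h1 : l = i
    · subst h1; rw [hwi, hp, expand, hga, hgb, hgab]; simp
    by_cases h2 : l = j
    · subst h2; rw [hwj, hq, expand, hga, hgb, hgab]; simp
    rw [hwo l h1 h2, hgv]
  -- Index `i` leaves the set of nonzero values; `j` was already in it, so the value at `q` is
  -- irrelevant.
  have hlt : (Finset.univ.filter fun l => h (w l) (w l) ≠ 0).card < m := by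
    rw [← hm]
    refine Finset.card_lt_card (Finset.ssubset_iff_of_subset ?_ |>.2 ⟨i, ?_, ?_⟩)
    · intro l hl
      simp only [Finset.mem_filter, Finset.mem_univ, true_and] at hl ⊢
      by_cases h1 : l = i
      · subst h1; exact absurd (by rw [hwi, hpz]) hl
      by_cases h2 : l = j
      · subst h2; rw [hre]; linarith
      rwa [hwo l h1 h2] at hl
    · simp only [Finset.mem_filter, Finset.mem_univ, true_and]
      rw [hre]; exact hi.ne'
    · simp [hwi, hpz]
  obtain ⟨u, hu1, hu2, hu3⟩ := ih _ hlt w hgw (by rw [hsw, hhv]) rfl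
  exact ⟨u, hu1, hu2, fun s => (hu3 s).trans (hsw s)⟩

/-- The sesquilinear form `(u, v) ↦ L (ū vᵀ)` attached to a linear functional on matrices. -/
def rankOneForm {n : Type*} (L : Matrix n n ℂ →ₗ[ℂ] ℂ) : (n → ℂ) →ₗ⋆[ℂ] (n → ℂ) →ₗ[ℂ] ℂ :=
  LinearMap.mk₂'ₛₗ (starRingEnd ℂ) (RingHom.id ℂ) (fun u v => L (Matrix.vecMulVec (star u) v))
    (fun u u' v => by rw [star_add, Matrix.add_vecMulVec, map_add])
    (fun c u v => by rw [star_smul, Matrix.smul_vecMulVec, map_smul]; rfl)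
    (fun u v v' => by rw [Matrix.vecMulVec_add, map_add])
    (fun c u v => by rw [Matrix.vecMulVec_smul, map_smul]; rfl)

/-- The linear functional `X ↦ conj (L Xᴴ)`. -/
def conjFunctional {n : Type*} (L : Matrix n n ℂ →ₗ[ℂ] ℂ) : Matrix n n ℂ →ₗ[ℂ] ℂ where
  toFun X := star (L Xᴴ)
  map_add' X Y := by simp
  map_smul' c X := by simp

/-- A linear functional on matrices that vanishes at the identity vanishes at every element of some
resolution of the identity into rank-one positive operators. -/
theorem exists_rankOne_resolution_of_apply_one_eq_zero {n : Type*} [Fintype n] [DecidableEq n]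
    (L : Matrix n n ℂ →ₗ[ℂ] ℂ) (hL : L 1 = 0) :
    ∃ w : n → n → ℂ, ∑ i, Matrix.vecMulVec (star (w i)) (w i) = 1 ∧
      ∀ i, L (Matrix.vecMulVec (star (w i)) (w i)) = 0 := by
  -- `L = (R - i J) / 2`, where `R` and `J` are real on Hermitian matrices and so give Hermitian
  -- forms.
  set R := L + conjFunctional L with hR
  set J := Complex.I • (L - conjFunctional L) with hJ
  have hct : ∀ u v : n → ℂ, (Matrix.vecMulVec (star u) v)ᴴ = Matrix.vecMulVec (star v) u :=
    fun u v => by rw [Matrix.conjTranspose_vecMulVec, star_star]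
  have hRs : ∀ u v, star (rankOneForm R u v) = rankOneForm R v u := fun u v => by
    simp [rankOneForm, hR, conjFunctional, hct, add_comm]
  have hJs : ∀ u v, star (rankOneForm J u v) = rankOneForm J v u := fun u v => by
    simp [rankOneForm, hJ, conjFunctional, hct]; ring
  set e : n → n → ℂ := fun i => Pi.single i 1 with he
  have he1 : ∑ i, Matrix.vecMulVec (star (e i)) (e i) = 1 := by
    ext a b
    simp [Matrix.sum_apply, Matrix.vecMulVec_apply, he, Pi.single_apply, Matrix.one_apply,
      apply_ite]
  have key : ∀ (K : Matrix n n ℂ →ₗ[ℂ] ℂ) (w : n → n → ℂ),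
      ∑ i, rankOneForm K (w i) (w i) = K (∑ i, Matrix.vecMulVec (star (w i)) (w i)) :=
    fun K w => by rw [map_sum]; rfl
  have hR1 : R 1 = 0 := by simp [hR, conjFunctional, hL]
  have hJ1 : J 1 = 0 := by simp [hJ, conjFunctional, hL]
  -- Isotropy for `R` is arranged first, with the trivial constraint `0`, and then kept as the
  -- constraint while `J` is treated.
  obtain ⟨v, -, hv, hvs⟩ := exists_frame_isotropic_of_sum_eq_zero 0 (rankOneForm R) (by simp) hRs e
    (by simp) (by rw [key, he1, hR1])
  obtain ⟨w, hw, hw', hws⟩ := exists_frame_isotropic_of_sum_eq_zero _ (rankOneForm J) hRs hJs v hv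
    (by rw [hvs, key, he1, hJ1])
  refine ⟨w, ?_, fun i => ?_⟩
  · rw [← he1]
    ext a b
    -- Matrix entries are linear functionals, so preserving all sesquilinear sums preserves the
    -- resolution of the identity.
    have := (hws (rankOneForm (Matrix.entryLinearMap ℂ ℂ a b))).trans (hvs _)
    rwa [key, key] at this
  · have h1 : R (Matrix.vecMulVec (star (w i)) (w i)) = 0 := hw i
    have h2 : J (Matrix.vecMulVec (star (w i)) (w i)) = 0 := hw' i
    simp only [hR, hJ, LinearMap.add_apply, LinearMap.smul_apply, LinearMap.sub_apply,
      smul_eq_mul, mul_eq_zero, Complex.I_ne_zero, false_or] at h1 h2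
    linear_combination (h1 + h2) / 2

end QuantumExclusion

namespace QuantumExclusion

/-! ### Algebra of local operators. -/

section LocalOp

variable {κ : Type*} [Fintype κ] [DecidableEq κ] {ι : κ → Type*} [∀ k, DecidableEq (ι k)]

theorem localOp_one (k : κ) : localOp k (1 : Matrix (ι k) (ι k) ℂ) = 1 := by
  ext x y
  simp only [localOp, Matrix.of_apply, Matrix.one_apply]
  by_cases h : x = y
  · simp [h]
  · rw [if_neg h]
    split_ifs with h1 h2
    · refine absurd (funext fun j => ?_) h
      by_cases hj : j = k
      · subst hj; exact h2
      · exact h1 j hj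
    · rfl
    · rfl

theorem localOp_add (k : κ) (A B : Matrix (ι k) (ι k) ℂ) :
    localOp k (A + B) = localOp k A + localOp k B := by
  ext x y
  simp only [localOp, Matrix.of_apply, Matrix.add_apply]
  split_ifs <;> simp

theorem localOp_smul (k : κ) (c : ℂ) (A : Matrix (ι k) (ι k) ℂ) :
    localOp k (c • A) = c • localOp k A := by
  ext x y
  simp [localOp, Matrix.smul_apply]

theorem localOp_conjTranspose (k : κ) (A : Matrix (ι k) (ι k) ℂ) :
    (localOp k A)ᴴ = localOp k Aᴴ := by
  ext x y
  simp only [localOp, Matrix.of_apply, Matrix.conjTranspose_apply, apply_ite star, star_zero,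
    eq_comm]

/-- `localOp` as a linear map. -/
def localOpLinearMap (k : κ) :
    Matrix (ι k) (ι k) ℂ →ₗ[ℂ] Matrix (∀ k, ι k) (∀ k, ι k) ℂ where
  toFun := localOp k
  map_add' := localOp_add k
  map_smul' := localOp_smul k

theorem localOp_sum (k : κ) {α : Type*} (s : Finset α) (A : α → Matrix (ι k) (ι k) ℂ) :
    localOp k (∑ a ∈ s, A a) = ∑ a ∈ s, localOp k (A a) :=
  map_sum (localOpLinearMap k) A s

variable [∀ k, Fintype (ι k)]

/-- Row `x` of `localOp k A` is supported on the indices that differ from `x` at most at `k`. -/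
theorem sum_localOp_mul (k : κ) (A : Matrix (ι k) (ι k) ℂ) (x : ∀ k, ι k) (f : (∀ k, ι k) → ℂ) :
    ∑ y, localOp k A x y * f y = ∑ a, A (x k) a * f (Function.update x k a) := by
  symm
  refine Finset.sum_of_injOn (fun a => Function.update x k a)
    (fun a _ b _ h => Function.update_injective x k h) (by simp) ?_ ?_
  · intro y _ hy
    rw [localOp, Matrix.of_apply, if_neg, zero_mul]
    intro h
    refine hy ⟨y k, by simp, funext fun j => ?_⟩
    by_cases hj : j = k
    · subst hj; simp
    · simp [hj, h j hj]
  · intro a _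
    have : ∀ j, j ≠ k → x j = Function.update x k a j := fun j hj => by simp [hj]
    simp only [localOp, Matrix.of_apply, if_pos this, Function.update_self]

theorem localOp_mul (k : κ) (A B : Matrix (ι k) (ι k) ℂ) :
    localOp k A * localOp k B = localOp k (A * B) := by
  ext x z
  rw [Matrix.mul_apply, sum_localOp_mul]
  have : ∀ a, localOp k B (Function.update x k a) z =
      if ∀ j, j ≠ k → x j = z j then B a (z k) else 0 := fun a => by
    simp only [localOp, Matrix.of_apply, Function.update_self]
    refine if_congr (forall₂_congr fun j hj => ?_) rfl rfl
    simp [hj]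
  simp only [this]
  by_cases h : ∀ j, j ≠ k → x j = z j
  · simp only [if_pos h, localOp, Matrix.of_apply, Matrix.mul_apply]
  · simp only [if_neg h, localOp, Matrix.of_apply, mul_zero, Finset.sum_const_zero]

theorem localOp_mulVec (k : κ) (A : Matrix (ι k) (ι k) ℂ) (f : (∀ k, ι k) → ℂ) (x : ∀ k, ι k) :
    (localOp k A *ᵥ f) x = ∑ a, A (x k) a * f (Function.update x k a) :=
  sum_localOp_mul k A x f

end LocalOp

/-! ### Local discrimination of two orthogonal vectors. -/

section Discrimination

variable {κ : Type*} [Fintype κ] [DecidableEq κ] {ι : κ → Type*}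
  [∀ k, Fintype (ι k)] [∀ k, DecidableEq (ι k)]

/-- Two orthogonal (unnormalized) state vectors that agree with a fixed product basis vector outside
the set `S` of parties are perfectly discriminated by a protocol in which each party of `S` measures
once. -/
theorem exists_locc_effect_mulVec_eq_zero (x₀ : ∀ k, ι k) (S : Finset κ) :
    ∀ f g : (∀ k, ι k) → ℂ, (∀ x, (∃ j ∉ S, x j ≠ x₀ j) → f x = 0) →
      (∀ x, (∃ j ∉ S, x j ≠ x₀ j) → g x = 0) → star f ⬝ᵥ g = 0 →
      ∃ P : LOCC ι (Fin 2), P.effect 1 *ᵥ f = 0 ∧ P.effect 0 *ᵥ g = 0 := by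
  induction S using Finset.induction_on with
  | empty =>
    intro f g hf hg hfg
    have hne : ∀ x, x ≠ x₀ → ∃ j ∉ (∅ : Finset κ), x j ≠ x₀ j := fun x hx => by
      simpa using Function.ne_iff.1 hx
    have h0 : star (f x₀) * g x₀ = 0 := by
      rw [← hfg, dotProduct, Finset.sum_eq_single x₀]
      · rfl
      · intro x _ hx; rw [hg x (hne x hx), mul_zero]
      · simp
    -- One of the two vectors is zero; the other is announced without measuring.
    rcases mul_eq_zero.1 h0 with h | h
    · refine ⟨.output 1, ?_, by simp [LOCC.effect]⟩
      have : f = 0 := funext fun x => by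
        by_cases hx : x = x₀
        · subst hx; exact star_eq_zero.1 h
        · exact hf x (hne x hx)
      simp [this]
    · refine ⟨.output 0, by simp [LOCC.effect], ?_⟩
      have : g = 0 := funext fun x => by
        by_cases hx : x = x₀
        · subst hx; exact h
        · exact hg x (hne x hx)
      simp [this]
  | insert k S hk ih =>
    intro f g hf hg hfg
    let L : Matrix (ι k) (ι k) ℂ →ₗ[ℂ] ℂ :=
      { toFun := fun X => star f ⬝ᵥ (localOp k X *ᵥ g)
        map_add' := fun X Y => by rw [localOp_add, Matrix.add_mulVec, dotProduct_add]
        map_smul' := fun c X => by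
          rw [localOp_smul, Matrix.smul_mulVec, dotProduct_smul]; rfl }
    obtain ⟨w, hw1, hwL⟩ := exists_rankOne_resolution_of_apply_one_eq_zero L
      (by change star f ⬝ᵥ (localOp k 1 *ᵥ g) = 0; rw [localOp_one, Matrix.one_mulVec, hfg])
    -- The bra `w i` fixes the effect; the ket is free, and the choice `x₀ k` gives the support
    -- condition for `S`.
    let A : ι k → Matrix (ι k) (ι k) ℂ := fun i => Matrix.vecMulVec (Pi.single (x₀ k) 1) (w i)
    have hA : ∀ i, (A i)ᴴ * A i = Matrix.vecMulVec (star (w i)) (w i) := fun i => by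
      simp only [A, Matrix.conjTranspose_vecMulVec, Matrix.vecMulVec_mul_vecMulVec]
      simp
    have supp : ∀ f : (∀ k, ι k) → ℂ, (∀ x, (∃ j ∉ insert k S, x j ≠ x₀ j) → f x = 0) →
        ∀ i x, (∃ j ∉ S, x j ≠ x₀ j) → (localOp k (A i) *ᵥ f) x = 0 := by
      rintro f hf i x ⟨j, hj, hxj⟩
      rw [localOp_mulVec]
      refine Finset.sum_eq_zero fun a _ => ?_
      by_cases hjk : j = k
      · subst hjk
        simp [A, Matrix.vecMulVec_apply, hxj]
      · rw [hf _ ⟨j, by simp [hj, hjk], by simpa [hjk] using hxj⟩, mul_zero]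
    -- The overlap after outcome `i` is `L ((A i)ᴴ * A i)`.
    have orth : ∀ i, star (localOp k (A i) *ᵥ f) ⬝ᵥ (localOp k (A i) *ᵥ g) = 0 := fun i => by
      rw [Matrix.star_mulVec, ← Matrix.dotProduct_mulVec, Matrix.mulVec_mulVec,
        localOp_conjTranspose, localOp_mul, hA]
      exact hwL i
    choose Q hQ1 hQ0 using fun i => ih _ _ (supp f hf i) (supp g hg i) (orth i)
    let e := (Fintype.equivFin (ι k)).symm
    refine ⟨.measure k (Fintype.card (ι k)) (fun a => A (e a)) ?_ (fun a => Q (e a)), ?_, ?_⟩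
    · rw [Equiv.sum_comp e fun i => (A i)ᴴ * A i]
      simpa only [hA] using hw1
    · simp only [LOCC.effect, Matrix.sum_mulVec, ← Matrix.mulVec_mulVec, hQ1, Matrix.mulVec_zero,
        Finset.sum_const_zero]
    · simp only [LOCC.effect, Matrix.sum_mulVec, ← Matrix.mulVec_mulVec, hQ0, Matrix.mulVec_zero,
        Finset.sum_const_zero]

end Discrimination

/-! ### Effects of protocols and Born probabilities. -/

section Effects

variable {κ : Type*} [Fintype κ] [DecidableEq κ] {ι : κ → Type*}
  [∀ k, Fintype (ι k)] [∀ k, DecidableEq (ι k)] {Ω : Type*} [DecidableEq Ω]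

theorem LOCC.posSemidef_effect (P : LOCC ι Ω) (ω : Ω) : (P.effect ω).PosSemidef := by
  induction P with
  | output ω' =>
    rw [LOCC.effect]
    split_ifs
    · exact Matrix.PosSemidef.one
    · exact Matrix.PosSemidef.zero
  | measure k n A h next ih =>
    rw [LOCC.effect]
    exact Matrix.posSemidef_sum _ fun a _ => (ih a).conjTranspose_mul_mul_same _

theorem LOCC.sum_effect [Fintype Ω] (P : LOCC ι Ω) : ∑ ω, P.effect ω = 1 := by
  induction P with
  | output ω' => simp [LOCC.effect]
  | measure k n A h next ih =>
    simp only [LOCC.effect]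
    rw [Finset.sum_comm]
    simp only [← Finset.sum_mul, ← Finset.mul_sum, ih, mul_one]
    simp only [localOp_conjTranspose, localOp_mul]
    rw [← localOp_sum, h, localOp_one]

theorem LOCC.effect_map [Fintype Ω] {Ω' : Type*} [DecidableEq Ω'] (P : LOCC ι Ω) (φ : Ω → Ω')
    (ω' : Ω') : (P.map φ).effect ω' = ∑ ω, if ω' = φ ω then P.effect ω else 0 := by
  induction P with
  | output ω =>
    simp only [LOCC.map, LOCC.effect]
    rw [Finset.sum_eq_single ω] <;> simp +contextual
  | measure k n A h next ih =>
    simp only [LOCC.map, LOCC.effect, ih, Finset.mul_sum, Finset.sum_mul]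
    rw [Finset.sum_comm]
    refine Finset.sum_congr rfl fun ω _ => ?_
    split_ifs <;> simp

end Effects

theorem trace_pureState_mul {X : Type*} [Fintype X] (ψ : EuclideanSpace ℂ X) (E : Matrix X X ℂ) :
    (pureState ψ * E).trace = star ψ.ofLp ⬝ᵥ (E *ᵥ ψ.ofLp) := by
  rw [pureState, Matrix.vecMulVec_mul, Matrix.trace_vecMulVec, dotProduct_comm,
    ← Matrix.dotProduct_mulVec]
  rfl

theorem prob_pureState_nonneg {X : Type*} [Fintype X] (ψ : EuclideanSpace ℂ X)
    {E : Matrix X X ℂ} (hE : E.PosSemidef) : 0 ≤ prob (pureState ψ) E := by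
  rw [prob, trace_pureState_mul]
  exact (Complex.le_def.1 (hE.dotProduct_mulVec_nonneg ψ.ofLp)).1

theorem prob_pureState_eq_one {X : Type*} [Fintype X] [DecidableEq X] {ψ : EuclideanSpace ℂ X}
    (hψ : ‖ψ‖ = 1) {E F : Matrix X X ℂ} (hEF : E + F = 1) (hF : F *ᵥ ψ.ofLp = 0) :
    prob (pureState ψ) E = 1 := by
  have hE : E *ᵥ ψ.ofLp = ψ.ofLp := by
    rw [eq_sub_of_add_eq hEF, Matrix.sub_mulVec, hF, Matrix.one_mulVec, sub_zero]
  have h1 : inner ℂ ψ ψ = 1 := by rw [inner_self_eq_norm_sq_to_K, hψ]; simp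
  rw [prob, trace_pureState_mul, hE, dotProduct_comm, ← EuclideanSpace.inner_eq_star_dotProduct, h1,
    Complex.one_re]

/-! ### The cyclic pairing. -/

section Pairing

theorem pairFst_ne_pairSnd {N : ℕ} (hN : 2 ≤ N) (i : Fin ((N + 1) / 2)) :
    pairFst N i ≠ pairSnd N i := by
  intro h
  have h' : 2 * (i : ℕ) = (2 * i + 1) % N := congrArg Fin.val h
  have := i.isLt
  rcases Nat.lt_or_ge (2 * (i : ℕ) + 1) N with h1 | h1
  · rw [Nat.mod_eq_of_lt h1] at h'; omega
  · have h2 : 2 * (i : ℕ) + 1 = N := by omega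
    rw [h2, Nat.mod_self] at h'; omega

theorem exists_pairFst_or_pairSnd_eq {N : ℕ} (j : Fin N) :
    ∃ i, pairFst N i = j ∨ pairSnd N i = j := by
  have hj := j.isLt
  refine ⟨⟨j / 2, by omega⟩, ?_⟩
  rcases Nat.even_or_odd' (j : ℕ) with ⟨c, hc | hc⟩
  · left
    refine Fin.ext ?_
    change 2 * ((j : ℕ) / 2) = j
    omega
  · right
    refine Fin.ext ?_
    change (2 * ((j : ℕ) / 2) + 1) % N = j
    rw [show 2 * ((j : ℕ) / 2) + 1 = j by omega, Nat.mod_eq_of_lt hj]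

end Pairing

/-! ### Exclusion with shared randomness. -/

section Randomized

variable {κ : Type*} [Fintype κ] [DecidableEq κ] {ι : κ → Type*}
  [∀ k, Fintype (ι k)] [∀ k, DecidableEq (ι k)]

/-- Shared randomness can be generated by one party, who measures with scalar Kraus operators. -/
theorem isLOCC_sum_smul_effect {Ω : Type*} [DecidableEq Ω] (k : κ) {m : ℕ} (p : Fin m → ℝ)
    (hp : ∀ i, 0 ≤ p i) (hp1 : ∑ i, p i = 1) (Q : Fin m → LOCC ι Ω) :
    IsLOCC fun ω => ∑ i, (p i : ℂ) • (Q i).effect ω := by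
  have hs : ∀ i, ((√(p i) : ℝ) : ℂ) * star ((√(p i) : ℝ) : ℂ) = p i := fun i => by
    rw [Complex.star_def, Complex.conj_ofReal, ← Complex.ofReal_mul, Real.mul_self_sqrt (hp i)]
  refine ⟨.measure k m (fun i => ((√(p i) : ℝ) : ℂ) • 1) ?_ Q, fun ω => ?_⟩
  · simp only [Matrix.conjTranspose_smul, Matrix.conjTranspose_one, Matrix.mul_smul,
      mul_one, smul_smul, hs]
    rw [← Finset.sum_smul, ← Complex.ofReal_sum, hp1, Complex.ofReal_one, one_smul]
  · simp only [LOCC.effect, localOp_smul, localOp_one, Matrix.conjTranspose_smul,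
      Matrix.conjTranspose_one, Matrix.smul_mul, Matrix.mul_smul, mul_one, one_mul, smul_smul, hs]

theorem isPOVM_sum_smul_effect {Ω : Type*} [Fintype Ω] [DecidableEq Ω] {m : ℕ} (p : Fin m → ℝ)
    (hp : ∀ i, 0 ≤ p i) (hp1 : ∑ i, p i = 1) (Q : Fin m → LOCC ι Ω) :
    IsPOVM fun ω => ∑ i, (p i : ℂ) • (Q i).effect ω where
  posSemidef ω := Matrix.posSemidef_sum _ fun i _ =>
    ((Q i).posSemidef_effect ω).smul (by exact_mod_cast hp i)
  sum_eq_one := by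
    rw [Finset.sum_comm]
    simp only [← Finset.smul_sum, LOCC.sum_effect]
    rw [← Finset.sum_smul, ← Complex.ofReal_sum, hp1, Complex.ofReal_one, one_smul]

theorem stronglyExcludes_randomizedExclusion {N : ℕ} (hN : 2 ≤ N)
    {ψ : Fin N → EuclideanSpace ℂ (∀ k, ι k)} (hψ : ∀ j, ‖ψ j‖ = 1)
    {P : Fin ((N + 1) / 2) → LOCC ι (Fin 2)}
    (h1 : ∀ i, (P i).effect 1 *ᵥ (ψ (pairFst N i)).ofLp = 0)
    (h0 : ∀ i, (P i).effect 0 *ᵥ (ψ (pairSnd N i)).ofLp = 0)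
    {p : Fin ((N + 1) / 2) → ℝ} (hp : ∀ i, 0 < p i) :
    StronglyExcludes (fun j => pureState (ψ j)) (randomizedExclusion p P) where
  perfect_exclusion j := by
    rw [trace_pureState_mul, randomizedExclusion, Matrix.sum_mulVec, Finset.sum_eq_zero,
      dotProduct_zero]
    intro i _
    rw [Matrix.smul_mulVec, LOCC.effect_map, Matrix.sum_mulVec, Finset.sum_eq_zero, smul_zero]
    intro o _
    fin_cases o
    · by_cases hj : j = pairSnd N i
      · simpa [hj] using h0 i
      · simp [hj]
    · by_cases hj : j = pairFst N i
      · simpa [hj] using h1 i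
      · simp [hj]
  outcome_relevance j := by
    have hsum : ∀ i, (P i).effect 0 + (P i).effect 1 = 1 := fun i => by
      rw [← (P i).sum_effect, Fin.sum_univ_two]
    have hprob : ∀ l, prob (pureState (ψ l)) (randomizedExclusion p P j) =
        ∑ i, p i * prob (pureState (ψ l)) (((P i).map
          fun o => if o = 0 then pairSnd N i else pairFst N i).effect j) := fun l => by
      simp only [prob, randomizedExclusion, Finset.mul_sum, Matrix.mul_smul, Matrix.trace_sum,
        Matrix.trace_smul, smul_eq_mul, Complex.re_sum, Complex.re_ofReal_mul]
    have hterm : ∀ l i, 0 ≤ p i * prob (pureState (ψ l)) (((P i).map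
          fun o => if o = 0 then pairSnd N i else pairFst N i).effect j) := fun l i =>
      mul_nonneg (hp i).le (prob_pureState_nonneg _ (LOCC.posSemidef_effect _ _))
    have hnonneg : ∀ l, 0 ≤ prob (pureState (ψ l)) (randomizedExclusion p P j) := fun l => by
      rw [hprob]; exact Finset.sum_nonneg fun i _ => hterm l i
    -- `l` is the partner of `j` in a pair containing `j`: on `ψ l` the protocol of that pair
    -- excludes `j` with certainty.
    obtain ⟨l, i, hli⟩ : ∃ l i, prob (pureState (ψ l)) (((P i).map
          fun o => if o = 0 then pairSnd N i else pairFst N i).effect j) = 1 := by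
      obtain ⟨i, rfl | rfl⟩ := exists_pairFst_or_pairSnd_eq j
      · refine ⟨pairSnd N i, i, ?_⟩
        rw [LOCC.effect_map, Fin.sum_univ_two]
        simpa [pairFst_ne_pairSnd hN i] using
          prob_pureState_eq_one (hψ _) ((add_comm _ _).trans (hsum i)) (h0 i)
      · refine ⟨pairFst N i, i, ?_⟩
        rw [LOCC.effect_map, Fin.sum_univ_two]
        simpa [(pairFst_ne_pairSnd hN i).symm] using
          prob_pureState_eq_one (hψ _) (hsum i) (h1 i)
    refine Finset.sum_pos' (fun l _ => hnonneg l) ⟨l, Finset.mem_univ _, ?_⟩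
    rw [hprob]
    exact Finset.sum_pos' (fun i _ => hterm l i) ⟨i, Finset.mem_univ _, by rw [hli]; simpa using hp i⟩

end Randomized

end QuantumExclusion

end

open QuantumExclusion
theorem lemma2 {κ : Type*} [Fintype κ] [DecidableEq κ] {ι : κ → Type*}
    [∀ k, Fintype (ι k)] [∀ k, DecidableEq (ι k)] {N : ℕ} (hN : 2 ≤ N)
    (ψ : Fin N → EuclideanSpace ℂ (∀ k, ι k)) (hψ : Orthonormal ℂ ψ) :
    LocallyAntidistinguishable (fun j => pureState (ψ j)) ∧
      ∃ P : Fin ((N + 1) / 2) → LOCC ι (Fin 2),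
        (∀ i, Discriminates (P i) (pureState (ψ (pairFst N i))) (pureState (ψ (pairSnd N i)))) ∧
        ∀ p : Fin ((N + 1) / 2) → ℝ, (∀ i, 0 < p i) → ∑ i, p i = 1 →
          IsPOVM (randomizedExclusion p P) ∧ IsLOCC (randomizedExclusion p P) ∧
            StronglyExcludes (fun j => pureState (ψ j)) (randomizedExclusion p P) := by
  -- Dimension at least two supplies the reference index `x₀` and, since an empty tensor product has
  -- dimension one, a party to generate the randomness.
  have hcard : 2 ≤ Fintype.card (∀ k, ι k) := by
    have h := hψ.linearIndependent.fintype_card_le_finrank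
    rw [finrank_euclideanSpace, Fintype.card_fin] at h
    omega
  have : Nonempty (∀ k, ι k) := Fintype.card_pos_iff.1 (by omega)
  obtain ⟨x₀⟩ := this
  obtain ⟨k⟩ : Nonempty κ := by
    by_contra hκ
    rw [not_nonempty_iff] at hκ
    rw [Fintype.card_unique] at hcard
    omega
  have hdisc : ∀ i, ∃ P : LOCC ι (Fin 2), P.effect 1 *ᵥ (ψ (pairFst N i)).ofLp = 0 ∧
      P.effect 0 *ᵥ (ψ (pairSnd N i)).ofLp = 0 := fun i => by
    refine exists_locc_effect_mulVec_eq_zero x₀ Finset.univ _ _ (by simp) (by simp) ?_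
    rw [dotProduct_comm, ← EuclideanSpace.inner_eq_star_dotProduct]
    exact hψ.2 (pairFst_ne_pairSnd hN i)
  choose P h1 h0 using hdisc
  have hsum : ∀ i, (P i).effect 0 + (P i).effect 1 = 1 := fun i => by
    rw [← (P i).sum_effect, Fin.sum_univ_two]
  have main : ∀ p : Fin ((N + 1) / 2) → ℝ, (∀ i, 0 < p i) → ∑ i, p i = 1 →
      IsPOVM (randomizedExclusion p P) ∧ IsLOCC (randomizedExclusion p P) ∧
        StronglyExcludes (fun j => pureState (ψ j)) (randomizedExclusion p P) :=
    fun p hp hp1 => ⟨isPOVM_sum_smul_effect p (fun i => (hp i).le) hp1 _,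
      isLOCC_sum_smul_effect k p (fun i => (hp i).le) hp1 _,
      stronglyExcludes_randomizedExclusion hN hψ.1 h1 h0 hp⟩
  have hm : 0 < (((N + 1) / 2 : ℕ) : ℝ) := by
    have : 0 < (N + 1) / 2 := by omega
    exact_mod_cast this
  refine ⟨⟨_, main (fun _ => (((N + 1) / 2 : ℕ) : ℝ)⁻¹) (fun _ => inv_pos.2 hm) ?_⟩, P,
    fun i => ⟨prob_pureState_eq_one (hψ.1 _) (hsum i) (h1 i),
      prob_pureState_eq_one (hψ.1 _) ((add_comm _ _).trans (hsum i)) (h0 i)⟩, main⟩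
  rw [Finset.sum_const, Finset.card_univ, Fintype.card_fin, nsmul_eq_mul, mul_inv_cancel₀ hm.ne']
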